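/- Work with pointed compactly generated spaces: products $X\times Y$ carry the compactly generated topology, $X\wedge Y=(X\times Y)/(X\vee Y)$, $\Sigma$ is the reduced suspension, $D^{(n)}$ is the $n$-fold smash power of $D$ (with $D^{(0)}=S^0$). The James construction $D_\infty$ is the free monoid on $D$ with the base point as unit, topologized as a quotient of $\coprod_n D^n$. For a pair $(X,A)$, the relative James construction $(X,A)_\infty$ (the words in $X_\infty$ whose letters after the first lie in $A$) is the push-out of $X\times A_\infty\leftarrow A\times A_\infty\to A_\infty$, where the second map is the product of $A_\infty$; and $\rho\colon (X,A)_\infty\to X/A$ sends a word to the class of its first letter and $A_\infty$ to the base point. Let $(X,A)=(\Sigma Y,\Sigma B)$ be a suspension pair, where $B$ is a closed subspace of the compactly generated space $Y$ containing the base point, and let $r\ge 1$. Put $D=A^{(r-1)}$, so that $A^{(r)}=A\wedge D\subset X\wedge D$. Let $u\colon D\to[0,\infty)$ be a continuous function that vanishes exactly at the base point (such a $u$ exists whenever there is such a function on $B$, e.g. if $B$ is well pointed). It defines James' map $D_\infty\to\Omega\Sigma D$, which sends $d_1\cdots d_m$ to the concatenation of the loops $s\mapsto[s/u(d_i),d_i]$,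 $0\le s\le u(d_i)$, reparametrized linearly to $[0,1]$; let $\lambda\colon\Sigma D_\infty\to\Sigma D$ be its adjoint and let $$\alpha\colon X\wedge D_\infty\cong Y\wedge\Sigma D_\infty\xrightarrow{\,1\wedge\lambda\,}Y\wedge\Sigma D\cong X\wedge D .$$ Then for every continuous map $H_{r-1}\colon A_\infty\to (A^{(r-1)})_\infty$ (not necessarily pointed) there is a pointed map $$h\colon (X,A)_\infty\longrightarrow (X\wedge A^{(r-1)},A^{(r)})_\infty$$ such that the composition $$X\times A_\infty\longrightarrow (X,A)_\infty\xrightarrow{\ h\ }(X\wedge A^{(r-1)},A^{(r)})_\infty\xrightarrow{\ \rho\ }(X\wedge A^{(r-1)})/A^{(r)}$$ is (pointed) homotopic to the composition $$X\times A_\infty\xrightarrow{1\times H_{r-1}}X\times (A^{(r-1)})_\infty\longrightarrow X\wedge (A^{(r-1)})_\infty\xrightarrow{\ \alpha\ }X\wedge A^{(r-1)}\longrightarrow (X\wedge A^{(r-1)})/A^{(r)} .$$ -/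

import Mathlib

open Set Topology unitInterval

universe u v

noncomputable section

/-! ### Compactly generated products and collapsed quotients -/

/-- The product of two spaces in the category of compactly generated spaces: the cartesian product
with the compactly generated refinement of the product topology. -/
def KProd (X : Type v) (Y : Type u) : Type (max v u) := X × Y

instance KProd.instTopologicalSpace (X : Type v) (Y : Type u) [TopologicalSpace X]
    [TopologicalSpace Y] : TopologicalSpace (KProd X Y) :=
  TopologicalSpace.compactlyGenerated.{max v u} (X × Y)

/-- The equivalence relation that identifies all points of `S` with each other. -/
def collapseSetoid {X : Type u} (S : Set X) : Setoid X where
  r x y := x = y ∨ (x ∈ S ∧ y ∈ S)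
  iseqv :=
    { refl := fun _ => Or.inl rfl
      symm := by
        rintro x y (h | h)
        · exact Or.inl h.symm
        · exact Or.inr ⟨h.2, h.1⟩
      trans := by
        rintro x y z (rfl | h) (rfl | h')
        · exact Or.inl rfl
        · exact Or.inr h'
        · exact Or.inr h
        · exact Or.inr ⟨h.1, h'.2⟩ }

/-- The quotient space `X / S`, with the quotient topology. -/
def Collapse {X : Type u} (S : Set X) : Type u := Quotient (collapseSetoid S)

namespace Collapse

instance {X : Type u} [TopologicalSpace X] (S : Set X) : TopologicalSpace (Collapse S) :=
  inferInstanceAs (TopologicalSpace (Quotient (collapseSetoid S)))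

/-- The quotient map `X → X / S`. -/
def mk {X : Type u} (S : Set X) (x : X) : Collapse S := Quotient.mk (collapseSetoid S) x

theorem mk_eq {X : Type u} {S : Set X} {x y : X} (hx : x ∈ S) (hy : y ∈ S) : mk S x = mk S y :=
  Quotient.sound (s := collapseSetoid S) (Or.inr ⟨hx, hy⟩)

/-- The map `X / S → Z` induced by a map that sends `S` to one point. -/
def lift {X : Type u} {S : Set X} {Z : Type v} (f : X → Z) (z : Z) (hf : ∀ x ∈ S, f x = z) :
    Collapse S → Z :=
  Quotient.lift (s := collapseSetoid S) f (by
    rintro x y (h | h)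
    · rw [h]
    · rw [hf x h.1, hf y h.2])

@[simp]
theorem lift_mk {X : Type u} {S : Set X} {Z : Type v} (f : X → Z) (z : Z)
    (hf : ∀ x ∈ S, f x = z) (x : X) : lift f z hf (mk S x) = f x := rfl

end Collapse

/-! ### Pointed spaces -/

/-- A topological space with a base point. -/
structure PtdSpace : Type (u + 1) where
  /-- the underlying set -/
  carrier : Type u
  /-- the topology -/
  [top : TopologicalSpace carrier]
  /-- the base point -/
  pt : carrier

namespace PtdSpace

instance : CoeSort PtdSpace.{u} (Type u) := ⟨PtdSpace.carrier⟩

instance (X : PtdSpace.{u}) : TopologicalSpace X := X.top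

/-- The product of pointed spaces. -/
def prod (X Y : PtdSpace.{u}) : PtdSpace.{u} where
  carrier := KProd X Y
  pt := (X.pt, Y.pt)

/-- The quotient `X / A` for `j : A → X` (the inclusion of a pointed subspace). -/
def quot {A X : PtdSpace.{u}} (j : A → X) : PtdSpace.{u} where
  carrier := Collapse (range j)
  pt := Collapse.mk _ X.pt

/-- The quotient map `X → X / A`. -/
def toQuot {A X : PtdSpace.{u}} (j : A → X) (x : X) : quot j := Collapse.mk (range j) x

/-- The wedge `X ∨ Y` as a subset of `X × Y`. -/
def wedge (X Y : PtdSpace.{u}) : Set (X.prod Y) := {p | p.1 = X.pt ∨ p.2 = Y.pt}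

/-- The smash product `X ∧ Y = X × Y / X ∨ Y`. -/
def smash (X Y : PtdSpace.{u}) : PtdSpace.{u} where
  carrier := Collapse (wedge X Y)
  pt := Collapse.mk _ (X.pt, Y.pt)

/-- The quotient map `X × Y → X ∧ Y`, as a function of two variables. -/
def smashMk {X Y : PtdSpace.{u}} (x : X) (y : Y) : X.smash Y := Collapse.mk (wedge X Y) (x, y)

theorem smashMk_eq_pt {X Y : PtdSpace.{u}} {x : X} {y : Y} (h : x = X.pt ∨ y = Y.pt) :
    smashMk x y = (X.smash Y).pt :=
  Collapse.mk_eq h (Or.inl rfl)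

/-- The map `f ∧ g` induced by pointed maps `f` and `g`. -/
def smashMap {X X' Y Y' : PtdSpace.{u}} (f : X → X') (hf : f X.pt = X'.pt)
    (g : Y → Y') (hg : g Y.pt = Y'.pt) : X.smash Y → X'.smash Y' :=
  Collapse.lift (fun p => smashMk (f p.1) (g p.2)) (X'.smash Y').pt (by
    rintro ⟨x, y⟩ (h | h)
    · exact smashMk_eq_pt (Or.inl (by rw [← hf]; exact congrArg f h))
    · exact smashMk_eq_pt (Or.inr (by rw [← hg]; exact congrArg g h)))

theorem smashMap_pt {X X' Y Y' : PtdSpace.{u}} (f : X → X') (hf : f X.pt = X'.pt)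
    (g : Y → Y') (hg : g Y.pt = Y'.pt) :
    smashMap f hf g hg (X.smash Y).pt = (X'.smash Y').pt :=
  smashMk_eq_pt (Or.inl hf)

/-- The `0`-sphere. -/
def sphereZero : PtdSpace.{u} where
  carrier := ULift.{u} Bool
  pt := ⟨false⟩

/-- The iterated smash product `X^{(n)} = X ∧ ⋯ ∧ X` with `n` factors; `X^{(0)} = S⁰`. -/
def smashPow (X : PtdSpace.{u}) : ℕ → PtdSpace.{u}
  | 0 => sphereZero
  | n + 1 => X.smash (smashPow X n)

/-- The part of the cylinder `I × X` that is collapsed in the reduced suspension. -/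
def suspSet (X : PtdSpace.{u}) : Set (KProd I X) := {p | p.1 = 0 ∨ p.1 = 1 ∨ p.2 = X.pt}

/-- The reduced suspension of `X`. -/
def susp (X : PtdSpace.{u}) : PtdSpace.{u} where
  carrier := Collapse (suspSet X)
  pt := Collapse.mk _ (0, X.pt)

/-- The quotient map `I × X → ΣX`, as a function of two variables. -/
def suspMk {X : PtdSpace.{u}} (t : I) (x : X) : X.susp := Collapse.mk (suspSet X) (t, x)

theorem suspMk_eq_pt {X : PtdSpace.{u}} {t : I} {x : X} (h : t = 0 ∨ t = 1 ∨ x = X.pt) :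
    suspMk t x = X.susp.pt :=
  Collapse.mk_eq h (Or.inl rfl)

/-- The suspension of a pointed map. -/
def suspMap {X Y : PtdSpace.{u}} (f : X → Y) (hf : f X.pt = Y.pt) : X.susp → Y.susp :=
  Collapse.lift (fun p => suspMk p.1 (f p.2)) Y.susp.pt (by
    rintro ⟨t, x⟩ (h | h | h)
    · exact suspMk_eq_pt (Or.inl h)
    · exact suspMk_eq_pt (Or.inr (Or.inl h))
    · exact suspMk_eq_pt (Or.inr (Or.inr (by rw [← hf]; exact congrArg f h))))

theorem suspMap_pt {X Y : PtdSpace.{u}} (f : X → Y) (hf : f X.pt = Y.pt) :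
    suspMap f hf X.susp.pt = Y.susp.pt :=
  suspMk_eq_pt (Or.inl rfl)

/-- The canonical identification `ΣY ∧ W → Y ∧ ΣW`, `[t, y] ∧ w ↦ y ∧ [t, w]`. -/
def suspSmashToSmashSusp (Y W : PtdSpace.{u}) : Y.susp.smash W → Y.smash W.susp :=
  Collapse.lift
    (fun p => Collapse.lift (fun q : KProd I Y => smashMk (X := Y) (Y := W.susp) q.2
        (suspMk q.1 p.2)) (Y.smash W.susp).pt (by
      rintro ⟨t, y⟩ (h | h | h)
      · exact smashMk_eq_pt (Or.inr (suspMk_eq_pt (Or.inl h)))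
      · exact smashMk_eq_pt (Or.inr (suspMk_eq_pt (Or.inr (Or.inl h))))
      · exact smashMk_eq_pt (Or.inl h)) p.1)
    (Y.smash W.susp).pt (by
      rintro ⟨x, w⟩ (h | h)
      · change x = Y.susp.pt at h
        subst h
        exact smashMk_eq_pt (Or.inl rfl)
      · change w = W.pt at h
        subst h
        induction x using Quotient.inductionOn with
        | h q => exact smashMk_eq_pt (Or.inr (suspMk_eq_pt (Or.inr (Or.inr rfl)))))

/-- The inverse identification `Y ∧ ΣW → ΣY ∧ W`, `y ∧ [t, w] ↦ [t, y] ∧ w`. -/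
def smashSuspToSuspSmash (Y W : PtdSpace.{u}) : Y.smash W.susp → Y.susp.smash W :=
  Collapse.lift
    (fun p => Collapse.lift (fun q : KProd I W => smashMk (X := Y.susp) (Y := W)
        (suspMk q.1 p.1) q.2) (Y.susp.smash W).pt (by
      rintro ⟨t, w⟩ (h | h | h)
      · exact smashMk_eq_pt (Or.inl (suspMk_eq_pt (Or.inl h)))
      · exact smashMk_eq_pt (Or.inl (suspMk_eq_pt (Or.inr (Or.inl h))))
      · exact smashMk_eq_pt (Or.inr h)) p.2)
    (Y.susp.smash W).pt (by
      rintro ⟨y, x⟩ (h | h)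
      · change y = Y.pt at h
        subst h
        induction x using Quotient.inductionOn with
        | h q => exact smashMk_eq_pt (Or.inl (suspMk_eq_pt (Or.inr (Or.inr rfl))))
      · change x = W.susp.pt at h
        subst h
        exact smashMk_eq_pt (Or.inr rfl))

/-- Pointed homotopy of (pointed) maps. The continuity of `f` and `g` is part of it. -/
def Homotopic {X Y : PtdSpace.{u}} (f g : X → Y) : Prop :=
  ∃ F : C(I × X, Y), (∀ x, F (0, x) = f x) ∧ (∀ x, F (1, x) = g x) ∧ ∀ t, F (t, X.pt) = Y.pt

/-! ### The James construction -/

/-- The set of reduced words, i.e. of finite words whose letters differ from the base point. -/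
def Word (X : PtdSpace.{u}) : Type u := {l : List X // ∀ x ∈ l, x ≠ X.pt}

open Classical in
/-- Delete from a word all letters equal to the base point. -/
def reduce {X : PtdSpace.{u}} (l : List X) : Word X :=
  ⟨l.filter (fun x => x ≠ X.pt), fun x hx => by simpa using (List.mem_filter.1 hx).2⟩

/-- The final topology for the maps `Xⁿ → X_∞`, where `Xⁿ` is the compactly generated product. -/
instance (X : PtdSpace.{u}) : TopologicalSpace (Word X) :=
  ⨆ n : ℕ, TopologicalSpace.coinduced (fun x : Fin n → X => reduce (List.ofFn x))
    (TopologicalSpace.compactlyGenerated.{u} (Fin n → X))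

/-- The James construction (reduced product space) `X_∞`: the free monoid on `X` with the base
point as unit, a quotient of the disjoint union of all the `Xⁿ`. -/
def james (X : PtdSpace.{u}) : PtdSpace.{u} where
  carrier := Word X
  pt := reduce []

/-- The product of `x` and the word `w` in the monoid `X_∞`. -/
def jamesCons {X : PtdSpace.{u}} (x : X) (w : X.james) : X.james := reduce (x :: w.1)

/-! ### The relative James construction -/

/-- The identifications `(j a, w) ∼ a w` in the disjoint union of `X × A_∞` and `A_∞`. -/
inductive RelJamesRel {A X : PtdSpace.{u}} (j : A → X) :
    (X.prod A.james) ⊕ A.james → (X.prod A.james) ⊕ A.james → Prop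
  | glue (a : A) (w : A.james) : RelJamesRel j (Sum.inl (j a, w)) (Sum.inr (jamesCons a w))

/-- The relative James construction `(X, A)_∞` for `j : A → X` (the inclusion of a pointed
subspace): the push-out of `X × A_∞ ← A × A_∞ → A_∞`, where the second map is multiplication. -/
def relJames {A X : PtdSpace.{u}} (j : A → X) : PtdSpace.{u} where
  carrier := Quot (RelJamesRel j)
  pt := Quot.mk _ (Sum.inl (X.pt, A.james.pt))

/-- The structure map `X × A_∞ → (X, A)_∞`. -/
def toRelJames {A X : PtdSpace.{u}} (j : A → X) (p : X.prod A.james) : relJames j :=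
  Quot.mk _ (Sum.inl p)

/-- The map `ρ : (X, A)_∞ → X / A` onto the orbit space of the action of `A_∞`: a word is sent to
the class of its first letter, and `A_∞` is sent to the base point. -/
def rho {A X : PtdSpace.{u}} (j : A → X) (hj : j A.pt = X.pt) : relJames j → quot j :=
  Quot.lift (Sum.elim (fun p => toQuot j p.1) (fun _ => (quot j).pt)) (by
    rintro _ _ ⟨a, w⟩
    exact Collapse.mk_eq ⟨a, rfl⟩ ⟨A.pt, hj⟩)

/-! ### The collapse `X ∧ D_∞ → X ∧ D` for a suspension `X` -/

/-- A continuous function that vanishes exactly at the base point. -/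
structure Weight (D : PtdSpace.{u}) where
  /-- the function -/
  toFun : D → ℝ
  continuous_toFun : Continuous toFun
  nonneg : ∀ d, 0 ≤ toFun d
  eq_zero_iff : ∀ d, toFun d = 0 ↔ d = D.pt

/-- The underlying map from the compactly generated product to the product is continuous. -/
theorem _root_.KProd.continuous_id (X : Type v) (Y : Type u) [TopologicalSpace X]
    [TopologicalSpace Y] : Continuous (fun p : KProd X Y => ((p.1, p.2) : X × Y)) := by
  refine continuous_coinduced_dom.2 (continuous_sigma fun f => ?_)
  exact f.2.continuous

/-- A weight on `D` gives the weight `[t, d] ↦ t (1 - t) u(d)` on `ΣD`. -/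
def Weight.susp {D : PtdSpace.{u}} (w : Weight D) : Weight D.susp where
  toFun := Collapse.lift (fun p : KProd I D => (p.1 : ℝ) * (1 - p.1) * w.toFun p.2) 0 (by
    rintro ⟨t, d⟩ (h | h | h) <;> change _ = _ at h <;> dsimp only at h ⊢
    · simp [h]
    · simp [h]
    · simp [(w.eq_zero_iff d).2 h])
  continuous_toFun := by
    have hw := w.continuous_toFun
    have h : Continuous (fun p : I × D => (p.1 : ℝ) * (1 - p.1) * w.toFun p.2) := by fun_prop
    exact (h.comp (KProd.continuous_id I D)).quotient_lift _
  nonneg := by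
    intro x
    induction x using Quotient.inductionOn with
    | h q => exact mul_nonneg (mul_nonneg q.1.2.1 (by linarith [q.1.2.2])) (w.nonneg q.2)
  eq_zero_iff := by
    intro x
    induction x using Quotient.inductionOn with
    | h q =>
      obtain ⟨t, d⟩ := q
      change (t : ℝ) * (1 - t) * w.toFun d = 0 ↔ suspMk t d = D.susp.pt
      constructor
      · intro h
        rcases mul_eq_zero.1 h with h | h
        · rcases mul_eq_zero.1 h with h | h
          · exact suspMk_eq_pt (Or.inl (Subtype.ext h))
          · exact suspMk_eq_pt (Or.inr (Or.inl (Subtype.ext (sub_eq_zero.1 h).symm)))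
        · exact suspMk_eq_pt (Or.inr (Or.inr ((w.eq_zero_iff d).1 h)))
      · intro h
        rcases Quotient.exact (s := collapseSetoid (suspSet D)) h with h | ⟨h, -⟩
        · cases h
          simp
        · rcases h with h | h | h <;> change _ = _ at h <;> dsimp only at h
          · simp [h]
          · simp [h]
          · simp [(w.eq_zero_iff d).2 h]

/-- Weights on `D` and `E` give the weight `d ∧ e ↦ u(d) v(e)` on `D ∧ E`. -/
def Weight.smash {D E : PtdSpace.{u}} (w : Weight D) (z : Weight E) : Weight (D.smash E) where
  toFun := Collapse.lift (fun p => w.toFun p.1 * z.toFun p.2) 0 (by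
    rintro ⟨d, e⟩ (h | h) <;> change _ = _ at h <;> dsimp only at h ⊢
    · simp [(w.eq_zero_iff d).2 h]
    · simp [(z.eq_zero_iff e).2 h])
  continuous_toFun := by
    have hw := w.continuous_toFun
    have hz := z.continuous_toFun
    have h : Continuous (fun p : D × E => w.toFun p.1 * z.toFun p.2) := by fun_prop
    exact (h.comp (KProd.continuous_id D E)).quotient_lift _
  nonneg := by
    intro x
    induction x using Quotient.inductionOn with
    | h q => exact mul_nonneg (w.nonneg q.1) (z.nonneg q.2)
  eq_zero_iff := by
    intro x
    induction x using Quotient.inductionOn with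
    | h q =>
      obtain ⟨d, e⟩ := q
      change w.toFun d * z.toFun e = 0 ↔ smashMk d e = (D.smash E).pt
      rw [mul_eq_zero, w.eq_zero_iff, z.eq_zero_iff]
      refine ⟨smashMk_eq_pt, fun h => ?_⟩
      rcases Quotient.exact (s := collapseSetoid (wedge D E)) h with h | ⟨h, -⟩
      · cases h
        exact Or.inl rfl
      · exact h

/-- A weight on `D` gives a weight on every smash power of `D`. -/
def Weight.smashPow {D : PtdSpace.{u}} (w : Weight D) : (n : ℕ) → Weight (D.smashPow n)
  | 0 =>
    { toFun := fun b : ULift Bool => cond b.down 1 0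
      continuous_toFun := continuous_of_discreteTopology (α := ULift Bool)
      nonneg := by rintro ⟨_ | _⟩ <;> simp
      eq_zero_iff := by
        rintro ⟨_ | _⟩
        · simp [PtdSpace.smashPow, sphereZero]
        · simp [PtdSpace.smashPow, sphereZero] }
  | n + 1 => w.smash (w.smashPow n)

/-- The Moore loop in `ΣD` defined by a word: it is the concatenation of the loops
`s ↦ [s / u d, d]` of length `u d`, one for each letter `d`. -/
def mooreLoop {D : PtdSpace.{u}} (u : Weight D) : List D → ℝ → D.susp
  | [], _ => D.susp.pt
  | d :: l, s =>
      open Classical in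
      if s ≤ u.toFun d then suspMk (projIcc 0 1 zero_le_one (s / u.toFun d)) d
      else mooreLoop u l (s - u.toFun d)

theorem mooreLoop_zero {D : PtdSpace.{u}} (u : Weight D) (l : List D) :
    mooreLoop u l 0 = D.susp.pt := by
  cases l with
  | nil => rfl
  | cons d l =>
    rw [mooreLoop, if_pos (u.nonneg d)]
    exact suspMk_eq_pt (Or.inl (by simp))

theorem mooreLoop_sum {D : PtdSpace.{u}} (u : Weight D) (l : List D) :
    mooreLoop u l (l.map u.toFun).sum = D.susp.pt := by
  induction l with
  | nil => rfl
  | cons d l ih =>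
    rw [List.map_cons, List.sum_cons, mooreLoop]
    split_ifs with h
    · have h0 : 0 ≤ (l.map u.toFun).sum := List.sum_nonneg (by
        intro a ha
        obtain ⟨d', -, rfl⟩ := List.mem_map.1 ha
        exact u.nonneg d')
      have h1 : (l.map u.toFun).sum = 0 := by linarith
      rw [h1, add_zero]
      by_cases hd : u.toFun d = 0
      · exact suspMk_eq_pt (Or.inr (Or.inr ((u.eq_zero_iff d).1 hd)))
      · rw [div_self hd]
        exact suspMk_eq_pt (Or.inr (Or.inl (by simp)))
    · rw [add_sub_cancel_left]
      exact ih

/-- The map `ΣD_∞ → ΣD` adjoint to James' map `D_∞ → ΩΣD` which extends `D → ΩΣD`: at time `t` it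
evaluates the Moore loop of a word at the proportion `t` of its length. -/
def jamesEval {D : PtdSpace.{u}} (u : Weight D) : D.james.susp → D.susp :=
  Collapse.lift (fun p : KProd I D.james => mooreLoop u p.2.1 (p.1 * (p.2.1.map u.toFun).sum))
    D.susp.pt (by
      rintro ⟨t, w⟩ (h | h | h)
      · change t = 0 at h
        subst h
        simpa using mooreLoop_zero u w.1
      · change t = 1 at h
        subst h
        simpa using mooreLoop_sum u w.1
      · change w = D.james.pt at h
        subst h
        rfl)

theorem jamesEval_pt {D : PtdSpace.{u}} (u : Weight D) :
    jamesEval u D.james.susp.pt = D.susp.pt := rfl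

/-- The map `α : ΣY ∧ D_∞ = Y ∧ ΣD_∞ → Y ∧ ΣD = ΣY ∧ D`. -/
def alpha (Y : PtdSpace.{u}) {D : PtdSpace.{u}} (u : Weight D) :
    Y.susp.smash D.james → Y.susp.smash D :=
  smashSuspToSuspSmash Y D ∘ smashMap id rfl (jamesEval u) (jamesEval_pt u) ∘
    suspSmashToSmashSusp Y D.james

end PtdSpace

end

/-!
Writing `T(v)` for the word `∏ₖ α(aₖ ∧ H(aₖ₊₁ ⋯ aₙ))` attached to `v = a₁ ⋯ aₙ ∈ A_∞`, the map `h`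
is `(x, v) ↦ α(x ∧ H(v)) · T(v)`. It respects the gluing `(a, v) ∼ a v` because
`T(a v) = α(a ∧ H(v)) · T(v)`, and `ρ` reads off its first letter, so the square commutes strictly.
All topology is in the continuity of `α`, which rests on two facts: a product with a fixed space
preserves quotient maps in the compactly generated setting, and the loop `s ↦ [s / u(d), d]` shrinks
uniformly to the base point as `u(d) → 0`.
-/

noncomputable section

/-! ### Maps out of and into compactly generated products -/

theorem continuous_compactlyGenerated_dom {X T : Type*} [TopologicalSpace X] [TopologicalSpace T]
    {f : X → T} (hf : ∀ (K : Type u) [TopologicalSpace K] [CompactSpace K] [T2Space K] (g : K → X),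
      Continuous g → Continuous fun c => f (g c)) :
    Continuous[TopologicalSpace.compactlyGenerated.{u} X, _] f :=
  continuous_from_compactlyGenerated f fun S g => hf S g g.continuous

theorem continuous_compactlyGenerated_rng {X : Type*} {K : Type*} [TopologicalSpace X]
    [TopologicalSpace K] [UCompactlyGeneratedSpace.{u} K] {g : K → X} (hg : Continuous g) :
    Continuous[_, TopologicalSpace.compactlyGenerated.{u} X] g := by
  let eval : (Σ i : (S : CompHaus.{u}) × C(S, X), i.fst) → X := fun p => p.1.2 p.2
  have heval : Continuous[_, TopologicalSpace.compactlyGenerated.{u} X] eval :=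
    continuous_coinduced_rng
  refine @continuous_from_uCompactlyGeneratedSpace _ _ _
    (TopologicalSpace.compactlyGenerated.{u} X) _ g fun S p => ?_
  exact (@continuous_sigma_iff _ _ _ _ (TopologicalSpace.compactlyGenerated.{u} X) _).1 heval
    ⟨S, ⟨g ∘ p, hg.comp p.continuous⟩⟩

namespace KProd

instance instUCompactlyGeneratedSpace (X : Type v) (Y : Type u) [TopologicalSpace X]
    [TopologicalSpace Y] : UCompactlyGeneratedSpace.{max v u} (KProd X Y) :=
  uCompactlyGeneratedSpace_of_coinduced continuous_coinduced_rng rfl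

variable {X : Type v} {Y : Type u} [TopologicalSpace X] [TopologicalSpace Y]

theorem continuous_fst : Continuous fun p : KProd X Y => p.1 :=
  _root_.continuous_fst.comp (KProd.continuous_id X Y)

theorem continuous_snd : Continuous fun p : KProd X Y => p.2 :=
  _root_.continuous_snd.comp (KProd.continuous_id X Y)

theorem continuous_mk {K : Type*} [TopologicalSpace K] [UCompactlyGeneratedSpace.{max v u} K]
    {a : K → X} {b : K → Y} (ha : Continuous a) (hb : Continuous b) :
    Continuous (Y := KProd X Y) fun c => (a c, b c) :=
  continuous_compactlyGenerated_rng (X := X × Y) (ha.prodMk hb)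

theorem continuous_swap : Continuous (Y := KProd Y X) fun p : KProd X Y => (p.2, p.1) :=
  continuous_mk continuous_snd continuous_fst

/-- The final topology on `Z` is preserved by the product with `X`: for a compact Hausdorff test
space `K → X × Z`, pass to the adjoint `Z → C(K, T)`. -/
theorem continuous_of_iSup_coinduced {Z : Type u} [tZ : TopologicalSpace Z] {ι : Type*}
    {W : ι → Type u} [∀ i, TopologicalSpace (W i)] {q : ∀ i, W i → Z}
    (hq : tZ = ⨆ i, (TopologicalSpace.compactlyGenerated.{max v u} (W i)).coinduced (q i))
    (hsurj : ∀ z, ∃ i x, q i x = z) {T : Type*} [TopologicalSpace T] {f : KProd X Z → T}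
    (hf : ∀ i, Continuous fun p : KProd X (W i) => f (p.1, q i p.2)) : Continuous f := by
  refine continuous_compactlyGenerated_dom (X := X × Z) fun K _ _ _ g hg => ?_
  have ha : Continuous fun c => (g c).1 := by fun_prop
  have hb : Continuous fun c => (g c).2 := by fun_prop
  have hslice (z : Z) : Continuous fun c => f ((g c).1, z) := by
    obtain ⟨i, x, rfl⟩ := hsurj z
    exact (hf i).comp (continuous_mk ha continuous_const)
  let adjoint : Z → C(K, T) := fun z => ⟨fun c => f ((g c).1, z), hslice z⟩
  have hadjoint : Continuous adjoint := by
    subst hq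
    refine continuous_iSup_dom.2 fun i => continuous_coinduced_dom.2 ?_
    refine continuous_compactlyGenerated_dom fun L _ _ _ x hx => ?_
    exact ContinuousMap.continuous_of_continuous_uncurry _ ((hf i).comp
      (continuous_mk (ha.comp _root_.continuous_snd) (hx.comp _root_.continuous_fst)))
  exact (ContinuousMap.continuous_uncurry_of_continuous ⟨adjoint, hadjoint⟩).comp
    (hb.prodMk _root_.continuous_id)

end KProd

theorem Collapse.continuous_mk {X : Type u} [TopologicalSpace X] (S : Set X) :
    Continuous (Collapse.mk S) :=
  continuous_quotient_mk'

theorem continuousAt_of_forall_eq {X L T : Type*} [TopologicalSpace X] [TopologicalSpace L]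
    [CompactSpace L] [TopologicalSpace T] {m : X × L → T} (hm : Continuous m) {x₀ : X} {z : T}
    (hz : ∀ t, m (x₀, t) = z) (τ : X → L) : ContinuousAt (fun x => m (x, τ x)) x₀ := by
  have hslice : Filter.Tendsto m (𝓝ˢ ({x₀} ×ˢ univ)) (𝓝 z) :=
    hm.tendsto_nhdsSet_nhds fun p hp => by rw [← hz p.2, ← mem_singleton_iff.1 hp.1]
  rw [isCompact_singleton.nhdsSet_prod_eq isCompact_univ, nhdsSet_singleton, nhdsSet_univ]
    at hslice
  rw [ContinuousAt, hz]
  exact hslice.comp (Filter.tendsto_id.prodMk Filter.tendsto_top)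

namespace PtdSpace

variable {X Y A B C D Z : PtdSpace.{u}} {K : Type u} [TopologicalSpace K]
  [UCompactlyGeneratedSpace.{u} K] {T : Type*} [TopologicalSpace T]

theorem continuous_smashMk {a : K → X} {b : K → Y} (ha : Continuous a) (hb : Continuous b) :
    Continuous fun c => smashMk (a c) (b c) :=
  (Collapse.continuous_mk (wedge X Y)).comp (KProd.continuous_mk ha hb)

theorem continuous_suspMk {t : K → I} {x : K → X} (ht : Continuous t) (hx : Continuous x) :
    Continuous fun c => suspMk (t c) (x c) :=
  (Collapse.continuous_mk (suspSet X)).comp (KProd.continuous_mk ht hx)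

theorem exists_suspMk_eq (z : X.susp) : ∃ t x, suspMk t x = z :=
  let ⟨p, hp⟩ := Quotient.exists_rep z
  ⟨p.1, p.2, hp⟩

theorem continuous_kprod_susp_dom {f : KProd Y X.susp → T}
    (hf : Continuous fun p : KProd Y (I × X) => f (p.1, suspMk p.2.1 p.2.2)) : Continuous f :=
  KProd.continuous_of_iSup_coinduced (ι := Unit) (W := fun _ => I × X)
    (q := fun _ p => suspMk p.1 p.2) (iSup_const (ι := Unit)).symm
    (fun z => let ⟨t, x, h⟩ := exists_suspMk_eq z; ⟨(), (t, x), h⟩) fun _ => hf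

/-! ### The James construction -/

theorem reduce_val (v : X.james) : reduce v.1 = v :=
  Subtype.ext (List.filter_eq_self.2 fun x hx => by simpa using v.2 x hx)

theorem reduce_cons_pt (l : List X) : reduce (X.pt :: l) = reduce l :=
  Subtype.ext (by simp [reduce])

theorem reduce_cons_of_ne {x : X} (hx : x ≠ X.pt) (l : List X) :
    (reduce (x :: l)).1 = x :: (reduce l).1 := by
  simp [reduce, hx]

theorem jamesCons_reduce (x : X) (l : List X) :
    jamesCons x (reduce l : X.james) = reduce (x :: l) :=
  Subtype.ext (by simp [jamesCons, reduce, List.filter_cons])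

theorem jamesCons_pt (v : X.james) : jamesCons X.pt v = v :=
  (reduce_cons_pt v.1).trans (reduce_val v)

theorem apply_reduce {S : Type*} {f : List X → S} (hpt : ∀ l, f (X.pt :: l) = f l)
    (hcons : ∀ x l, f (reduce l).1 = f l → f (x :: (reduce l).1) = f (x :: l)) (l : List X) :
    f (reduce l).1 = f l := by
  induction l with
  | nil => rfl
  | cons x l ih =>
    by_cases hx : x = X.pt
    · rw [hx, reduce_cons_pt, hpt, ih]
    · rw [reduce_cons_of_ne hx, hcons x l ih]

theorem continuous_reduce_ofFn {n : ℕ} {x : K → Fin n → X} (hx : Continuous x) :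
    Continuous fun c => (reduce (List.ofFn (x c)) : X.james) := by
  have hreduce : Continuous[TopologicalSpace.compactlyGenerated.{u} (Fin n → X), X.james.top]
      (fun x : Fin n → X => (reduce (List.ofFn x) : X.james)) :=
    continuous_iSup_rng (i := n) continuous_coinduced_rng
  exact @Continuous.comp _ _ _ _ (TopologicalSpace.compactlyGenerated.{u} (Fin n → X)) _ _ _
    hreduce (continuous_compactlyGenerated_rng hx)

theorem continuous_james_dom {f : X.james → T}
    (hf : ∀ (n : ℕ) (K : Type u) [TopologicalSpace K] [CompactSpace K] [T2Space K]
      (x : K → Fin n → X), Continuous x → Continuous fun c => f (reduce (List.ofFn (x c)))) :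
    Continuous f :=
  continuous_iSup_dom.2 fun n => continuous_coinduced_dom.2 <|
    continuous_compactlyGenerated_dom fun K _ _ _ x hx => hf n K x hx

theorem exists_reduce_ofFn_eq (v : X.james) : ∃ n, ∃ x : Fin n → X, reduce (List.ofFn x) = v :=
  ⟨v.1.length, v.1.get, by rw [List.ofFn_get]; exact reduce_val v⟩

theorem continuous_jamesCons : Continuous fun p : KProd X X.james => jamesCons p.1 p.2 := by
  refine KProd.continuous_of_iSup_coinduced rfl exists_reduce_ofFn_eq fun n => ?_
  have hcons : Continuous fun p : KProd X (Fin n → X) =>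
      (Fin.cons p.1 p.2 : Fin (n + 1) → X) :=
    Continuous.finCons (A := fun _ => X) KProd.continuous_fst KProd.continuous_snd
  refine (continuous_reduce_ofFn hcons).congr fun p => ?_
  rw [jamesCons_reduce, List.ofFn_cons]

/-! ### The collapse `α` -/

theorem continuous_suspMk_div (u : Weight D) {s : K → ℝ} {d : K → D} (hs : Continuous s)
    (hd : Continuous d) :
    Continuous fun c => suspMk (projIcc 0 1 zero_le_one (s c / u.toFun (d c))) (d c) := by
  refine continuous_le_dom UCompactlyGeneratedSpace.le_compactlyGenerated
    (continuous_compactlyGenerated_dom fun L _ _ _ g hg => ?_)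
  have hmk : Continuous fun p : L × I => suspMk p.2 (d (g p.1)) :=
    continuous_suspMk continuous_snd (hd.comp (hg.comp continuous_fst))
  refine continuous_iff_continuousAt.2 fun c₀ => ?_
  by_cases h₀ : u.toFun (d (g c₀)) = 0
  · -- `s / u d` need not be continuous here, but the whole loop `t ↦ [t, d]` is constant.
    exact continuousAt_of_forall_eq hmk
      (fun t => suspMk_eq_pt (Or.inr (Or.inr ((u.eq_zero_iff _).1 h₀)))) _
  · have hdiv : ContinuousAt (fun c => projIcc (0 : ℝ) 1 zero_le_one
        (s (g c) / u.toFun (d (g c)))) c₀ :=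
      continuous_projIcc.continuousAt.comp <| (hs.comp hg).continuousAt.div
        (u.continuous_toFun.comp (hd.comp hg)).continuousAt h₀
    exact hmk.continuousAt.comp (continuousAt_id.prodMk hdiv)

theorem suspMk_div_self (u : Weight D) (d : D) :
    suspMk (projIcc 0 1 zero_le_one (u.toFun d / u.toFun d)) d = D.susp.pt := by
  by_cases hd : u.toFun d = 0
  · exact suspMk_eq_pt (Or.inr (Or.inr ((u.eq_zero_iff d).1 hd)))
  · rw [div_self hd]
    exact suspMk_eq_pt (Or.inr (Or.inl (projIcc_right _)))

theorem continuous_mooreLoop (u : Weight D) {n : ℕ} {s : K → ℝ} {x : K → Fin n → D}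
    (hs : Continuous s) (hx : Continuous x) :
    Continuous fun c => mooreLoop u (List.ofFn (x c)) (s c) := by
  induction n generalizing s with
  | zero => simpa [mooreLoop] using continuous_const
  | succ n ih =>
    have hhead : Continuous fun c => x c 0 := (continuous_apply 0).comp hx
    have htail : Continuous fun c => Fin.tail (x c) := hx.finTail
    have hu : Continuous fun c => u.toFun (x c 0) := u.continuous_toFun.comp hhead
    simp only [List.ofFn_succ, mooreLoop]
    refine Continuous.if_le (continuous_suspMk_div u hs hhead) (ih (hs.sub hu) htail) hs hu ?_
    intro c hc
    rw [hc, sub_self, mooreLoop_zero, suspMk_div_self]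

theorem mooreLoop_of_nonpos (u : Weight D) (l : List D) {s : ℝ} (hs : s ≤ 0) :
    mooreLoop u l s = D.susp.pt := by
  cases l with
  | nil => rfl
  | cons d l =>
    rw [mooreLoop, if_pos (hs.trans (u.nonneg d))]
    exact suspMk_eq_pt (Or.inl (projIcc_of_le_left _
      (div_nonpos_of_nonpos_of_nonneg hs (u.nonneg d))))

theorem mooreLoop_reduce (u : Weight D) (l : List D) :
    mooreLoop u (reduce l).1 = mooreLoop u l := by
  refine apply_reduce (fun l => funext fun s => ?_) (fun d l ih => funext fun s => ?_) l
  · rw [mooreLoop, (u.eq_zero_iff D.pt).2 rfl, sub_zero]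
    split_ifs with hs
    · rw [mooreLoop_of_nonpos u l hs]
      exact suspMk_eq_pt (Or.inr (Or.inr rfl))
    · rfl
  · rw [mooreLoop, mooreLoop, ih]

theorem sum_map_reduce (u : Weight D) (l : List D) :
    ((reduce l).1.map u.toFun).sum = (l.map u.toFun).sum :=
  apply_reduce (f := fun l => (l.map u.toFun).sum)
    (fun l => by simp [(u.eq_zero_iff D.pt).2 rfl]) (fun d l ih => by simpa using ih) l

theorem jamesEval_suspMk_reduce (u : Weight D) (t : I) (l : List D) :
    jamesEval u (suspMk t (reduce l)) = mooreLoop u l (t * (l.map u.toFun).sum) := by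
  rw [← mooreLoop_reduce, ← sum_map_reduce]
  rfl

theorem continuous_jamesEval (u : Weight D) :
    Continuous fun p : KProd I D.james => jamesEval u (suspMk p.1 p.2) := by
  refine KProd.continuous_of_iSup_coinduced rfl exists_reduce_ofFn_eq fun n => ?_
  have hu := u.continuous_toFun
  have ht : Continuous fun p : KProd I (Fin n → D) => p.1 := KProd.continuous_fst
  have hx : Continuous fun p : KProd I (Fin n → D) => p.2 := KProd.continuous_snd
  have hs : Continuous fun p : KProd I (Fin n → D) => (p.1 : ℝ) * ∑ k, u.toFun (p.2 k) := by
    fun_prop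
  refine (continuous_mooreLoop u hs hx).congr fun p => ?_
  rw [jamesEval_suspMk_reduce, List.map_ofFn, List.sum_ofFn]
  rfl

theorem continuous_smashSuspToSuspSmash (Y W : PtdSpace.{u}) :
    Continuous fun p : KProd Y W.susp => smashSuspToSuspSmash Y W (smashMk p.1 p.2) :=
  continuous_kprod_susp_dom <| continuous_smashMk
    (continuous_suspMk (continuous_fst.comp KProd.continuous_snd) KProd.continuous_fst)
    (continuous_snd.comp KProd.continuous_snd)

theorem continuous_alpha (Y : PtdSpace.{u}) (u : Weight D) :
    Continuous fun p : KProd Y.susp D.james => alpha Y u (smashMk p.1 p.2) := by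
  have hflip : Continuous fun p : KProd D.james Y.susp => alpha Y u (smashMk p.2 p.1) :=
    continuous_kprod_susp_dom <| (continuous_smashSuspToSuspSmash Y D).comp <| KProd.continuous_mk
      (continuous_snd.comp KProd.continuous_snd)
      ((continuous_jamesEval u).comp <|
        KProd.continuous_mk (continuous_fst.comp KProd.continuous_snd) KProd.continuous_fst)
  exact hflip.comp KProd.continuous_swap

theorem alpha_pt (Y : PtdSpace.{u}) (u : Weight D) (v : D.james) :
    alpha Y u (smashMk Y.susp.pt v) = (Y.susp.smash D).pt := by
  rw [smashMk_eq_pt (Or.inl rfl)]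
  exact smashMk_eq_pt (Or.inr rfl)

theorem smashSuspToSuspSmash_apply_left (i : B → Y) (hi : i B.pt = Y.pt) (b : B) (z : D.susp) :
    smashSuspToSuspSmash Y D (smashMk (i b) z) =
      smashMap (suspMap i hi) (suspMap_pt i hi) id rfl
        (smashSuspToSuspSmash B D (smashMk b z)) := by
  obtain ⟨t, d, rfl⟩ := exists_suspMk_eq z
  rfl

theorem alpha_suspMap (i : B → Y) (hi : i B.pt = Y.pt) (u : Weight D) (a : B.susp)
    (v : D.james) :
    alpha Y u (smashMk (suspMap i hi a) v) =
      smashMap (suspMap i hi) (suspMap_pt i hi) id rfl (alpha B u (smashMk a v)) := by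
  obtain ⟨t, b, rfl⟩ := exists_suspMk_eq a
  exact smashSuspToSuspSmash_apply_left i hi b (jamesEval u (suspMk t v))

/-! ### Maps between relative James constructions -/

/-- The inclusion `A_∞ → (X, A)_∞`. -/
def jamesToRelJames (j : A → X) (v : A.james) : relJames j :=
  Quot.mk _ (Sum.inr v)

theorem toRelJames_glue (j : A → X) (a : A) (v : A.james) :
    toRelJames j (j a, v) = jamesToRelJames j (jamesCons a v) :=
  Quot.sound (RelJamesRel.glue a v)

theorem continuous_toRelJames (j : A → X) : Continuous (toRelJames j) :=
  continuous_quot_mk.comp continuous_inl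

theorem continuous_jamesToRelJames (j : A → X) : Continuous (jamesToRelJames j) :=
  continuous_quot_mk.comp continuous_inr

/-- The map out of the push-out `(X, A)_∞` given by compatible maps on `X × A_∞` and `A_∞`. -/
def relJamesDesc {S : Type*} {j : A → X} (f : X.prod A.james → S) (g : A.james → S)
    (hfg : ∀ a v, f (j a, v) = g (jamesCons a v)) : relJames j → S :=
  Quot.lift (Sum.elim f g) (by
    rintro _ _ ⟨a, v⟩
    exact hfg a v)

theorem continuous_relJamesDesc {j : A → X} {f : X.prod A.james → T} {g : A.james → T}
    (hfg : ∀ a v, f (j a, v) = g (jamesCons a v)) (hf : Continuous f) (hg : Continuous g) :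
    Continuous (relJamesDesc f g hfg) :=
  continuous_quot_lift _ (hf.sumElim hg)

theorem continuous_rho (j : A → X) (hj : j A.pt = X.pt) : Continuous (rho j hj) :=
  continuous_quot_lift _ <|
    ((Collapse.continuous_mk (range j)).comp KProd.continuous_fst).sumElim continuous_const

/-- The word `∏ₖ ψ(aₖ, aₖ₊₁ ⋯ aₙ)` attached to the list `a₁, …, aₙ`. -/
def jamesExtendList (ψ : A.prod A.james → C) : List A → C.james
  | [] => C.james.pt
  | a :: l => jamesCons (ψ (a, reduce l)) (jamesExtendList ψ l)

/-- The combinatorial extension `A_∞ → C_∞` of `ψ : A × A_∞ → C`, characterized for pointed `ψ` by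
`a v ↦ ψ(a, v) · jamesExtend ψ v`. -/
def jamesExtend (ψ : A.prod A.james → C) (v : A.james) : C.james :=
  jamesExtendList ψ v.1

theorem jamesExtend_reduce {ψ : A.prod A.james → C} (hψ : ∀ v, ψ (A.pt, v) = C.pt) (l : List A) :
    jamesExtend ψ (reduce l) = jamesExtendList ψ l := by
  refine apply_reduce (fun l => ?_) (fun a l ih => ?_) l
  · exact (congrArg (jamesCons · _) (hψ (reduce l))).trans (jamesCons_pt _)
  · rw [jamesExtendList, jamesExtendList, ih]
    exact congrArg (fun v => jamesCons (ψ (a, v)) _) (reduce_val (reduce l))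

theorem jamesExtend_jamesCons {ψ : A.prod A.james → C} (hψ : ∀ v, ψ (A.pt, v) = C.pt) (a : A)
    (v : A.james) :
    jamesExtend ψ (jamesCons a v) = jamesCons (ψ (a, v)) (jamesExtend ψ v) := by
  rw [jamesCons, jamesExtend_reduce hψ, jamesExtendList, reduce_val, jamesExtend]

theorem continuous_jamesExtendList {ψ : A.prod A.james → C} (hψ : Continuous ψ) {n : ℕ}
    {x : K → Fin n → A} (hx : Continuous x) :
    Continuous fun c => jamesExtendList ψ (List.ofFn (x c)) := by
  induction n with
  | zero => simpa [jamesExtendList] using continuous_const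
  | succ n ih =>
    have hhead : Continuous fun c => x c 0 := (continuous_apply 0).comp hx
    have htail : Continuous fun c => Fin.tail (x c) := hx.finTail
    simp only [List.ofFn_succ, jamesExtendList]
    exact continuous_jamesCons.comp <| KProd.continuous_mk
      (hψ.comp (KProd.continuous_mk hhead (continuous_reduce_ofFn htail))) (ih htail)

theorem continuous_jamesExtend {ψ : A.prod A.james → C} (hψ : ∀ v, ψ (A.pt, v) = C.pt)
    (hc : Continuous ψ) : Continuous (jamesExtend ψ) := by
  refine continuous_james_dom fun n K _ _ _ x hx => ?_
  simp only [jamesExtend_reduce hψ]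
  exact continuous_jamesExtendList hc hx

/-- The map `(X, A)_∞ → (Z, C)_∞`, `(x, v) ↦ φ(x, v) · jamesExtend ψ v`, defined by a map
`φ : X × A_∞ → Z` that restricts to `ψ : A × A_∞ → C`. -/
def relJamesExtend {j : A → X} {k : C → Z} (φ : X.prod A.james → Z) (ψ : A.prod A.james → C)
    (hψ : ∀ v, ψ (A.pt, v) = C.pt) (hφψ : ∀ a v, φ (j a, v) = k (ψ (a, v))) :
    relJames j → relJames k :=
  relJamesDesc (fun p => toRelJames k (φ p, jamesExtend ψ p.2))
    (fun v => jamesToRelJames k (jamesExtend ψ v))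
    (fun a v => by rw [hφψ, toRelJames_glue, jamesExtend_jamesCons hψ])

theorem continuous_relJamesExtend {j : A → X} {k : C → Z} {φ : X.prod A.james → Z}
    {ψ : A.prod A.james → C} (hψ : ∀ v, ψ (A.pt, v) = C.pt)
    (hφψ : ∀ a v, φ (j a, v) = k (ψ (a, v))) (hφc : Continuous φ) (hψc : Continuous ψ) :
    Continuous (relJamesExtend φ ψ hψ hφψ) := by
  have hext : Continuous (jamesExtend ψ) := continuous_jamesExtend hψ hψc
  have hpair : Continuous (X := KProd X A.james) (Y := KProd Z C.james)
      fun p => (φ p, jamesExtend ψ p.2) :=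
    KProd.continuous_mk hφc (hext.comp KProd.continuous_snd)
  exact continuous_relJamesDesc _ ((continuous_toRelJames k).comp hpair)
    ((continuous_jamesToRelJames k).comp hext)

theorem Homotopic.of_eq {f g : X → Y} (hf : Continuous f) (hpt : f X.pt = Y.pt)
    (hfg : ∀ x, f x = g x) : Homotopic f g :=
  ⟨⟨fun q => f q.2, hf.comp continuous_snd⟩, fun _ => rfl, hfg, fun _ => hpt⟩

end PtdSpace

end

open PtdSpace in
theorem theorem5p1_general (Y B D : PtdSpace.{u}) (i : B → Y) (hi : i B.pt = Y.pt)
    (H : C(B.susp.james, D.james)) (u : Weight D) :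
    let j : B.susp → Y.susp := suspMap i hi
    let k : B.susp.smash D → Y.susp.smash D := smashMap j (suspMap_pt i hi) id rfl
    let hk : k (B.susp.smash D).pt = (Y.susp.smash D).pt := smashMap_pt j (suspMap_pt i hi) id rfl
    ∃ h : C(relJames j, relJames k), h (relJames j).pt = (relJames k).pt ∧
      ∀ (x : Y.susp) (v : B.susp.james),
        rho k hk (h (toRelJames j (x, v))) = toQuot k (alpha Y u (smashMk x (H v))) := by
  intro j k hk
  let φ (V : PtdSpace.{u}) (p : V.susp.prod B.susp.james) : V.susp.smash D :=
    alpha V u (smashMk p.1 (H p.2))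
  have hφ (V : PtdSpace.{u}) : Continuous (φ V) := (continuous_alpha V u).comp <|
    KProd.continuous_mk KProd.continuous_fst (H.continuous.comp KProd.continuous_snd)
  have hφ_pt (V : PtdSpace.{u}) (v : B.susp.james) : φ V (V.susp.pt, v) = (V.susp.smash D).pt :=
    alpha_pt V u (H v)
  have hφ_restrict (a : B.susp) (v : B.susp.james) : φ Y (j a, v) = k (φ B (a, v)) :=
    alpha_suspMap i hi u a (H v)
  refine ⟨⟨relJamesExtend (φ Y) (φ B) (hφ_pt B) hφ_restrict,
    continuous_relJamesExtend _ _ (hφ Y) (hφ B)⟩, ?_, fun x v => rfl⟩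
  exact congrArg (fun z => toRelJames k (z, (B.susp.smash D).james.pt))
    (hφ_pt Y B.susp.james.pt)

/-- Here `(X, A) = (ΣY, ΣB)` for a pointed pair `i : B ⊆ Y`, and `r = n + 1`. -/
theorem theorem5p1 (Y B : PtdSpace.{u}) [CompactlyGeneratedSpace Y]
    (i : B → Y) (hi : IsClosedEmbedding i) (hpt : i B.pt = Y.pt) (n : ℕ)
    (H : C((B.susp).james, (B.susp.smashPow n).james))
    (w : PtdSpace.Weight (B.susp.smashPow n)) :
    let X : PtdSpace.{u} := Y.susp
    let A : PtdSpace.{u} := B.susp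
    let j : A → X := PtdSpace.suspMap i hpt
    let hj : j A.pt = X.pt := PtdSpace.suspMap_pt i hpt
    -- the inclusion of `A^{(r)}` into `X ∧ A^{(r-1)}`
    let k : A.smashPow (n + 1) → X.smash (A.smashPow n) := PtdSpace.smashMap j hj id rfl
    let hk : k (A.smashPow (n + 1)).pt = (X.smash (A.smashPow n)).pt :=
      PtdSpace.smashMap_pt j hj id rfl
    ∃ h : C(PtdSpace.relJames j, PtdSpace.relJames k),
      h (PtdSpace.relJames j).pt = (PtdSpace.relJames k).pt ∧
      PtdSpace.Homotopic (X := X.prod A.james) (Y := PtdSpace.quot k)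
        (fun p => PtdSpace.rho k hk (h (PtdSpace.toRelJames j p)))
        (fun p => PtdSpace.toQuot k
          (PtdSpace.alpha Y w (PtdSpace.smashMk (Y := (A.smashPow n).james) p.1 (H p.2)))) := by
  intro X A j hj k hk
  obtain ⟨h, hh, hρ⟩ := theorem5p1_general Y B (A.smashPow n) i hpt H w
  exact ⟨h, hh, .of_eq
    ((PtdSpace.continuous_rho k hk).comp (h.continuous.comp (PtdSpace.continuous_toRelJames j)))
    (congrArg (PtdSpace.rho k hk) hh) fun p => hρ p.1 p.2⟩
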